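/- Let $a\ge 1$ and $M$ be integers, let $g_0,\dots,g_{M-1}\in\ell^2(\mathbb Z)$, and put $g_{m,n}(k)=g_m(k-na)$ for $k,n\in\mathbb Z$, $0\le m\le M-1$. Suppose that $\{g_{m,n}\}$ is a frame for $\ell^2(\mathbb Z)$ with frame bounds $A,B>0$, i.e. $A\|f\|^2\le\sum_{m,n}|\langle f,g_{m,n}\rangle|^2\le B\|f\|^2$ for all $f\in\ell^2(\mathbb Z)$, and let $Sf=\sum_{m,n}\langle f,g_{m,n}\rangle g_{m,n}$ be its frame operator. For $N\in\mathbb N=\{0,1,2,\dots\}$ let $P_N$ be the orthogonal projection of $\ell^2(\mathbb Z)$ onto the sequences supported in $[-N,N]$. (1) The finite section method is applicable to $S^{1/2}$: there is $N_0$ such that, for every $y\in\ell^2(\mathbb Z)$ and every $N\ge N_0$, the equation $P_NS^{1/2}P_Nx^{(N)}=P_Ny$ has a unique solution $x^{(N)}\in\operatorname{Im}P_N$, and for every $y$ the vectors $x^{(N)}$ converge in $\ell^2(\mathbb Z)$, as $N\to\infty$, to the unique solution $x$ of $S^{1/2}x=y$. (2) Put $\varphi_m=S^{-1/2}g_m$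 and $\varphi_m^{(N)}=(P_NSP_N)^{-1/2}P_Ng_m$, where $P_NSP_N$ is regarded as a positive invertible operator on $\operatorname{Im}P_N$. For all $A,B>0$ and every integer $s\ge 0$ there are constants $\beta\in(0,1)$ and $K>0$, depending only on $A$, $B$ and $s$, such that for every shift-invariant frame as above with frame bounds $A,B$ (with any $a$, $M$ and $g_0,\dots,g_{M-1}$) whose generators all satisfy $g_m(k)=0$ for $|k|>s$, $$\|\varphi_m-\varphi_m^{(N)}\|\le K\beta^N\qquad\text{for all } m=0,\dots,M-1 \text{ and } N=0,1,2,\dots$$ -/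

import Mathlib

open scoped InnerProductSpace

noncomputable section

namespace ShiftInvariant

/-- The complex Hilbert space `ℓ²(ℤ)`. -/
abbrev L2Z : Type := lp (fun _ : ℤ => ℂ) 2

/-- The sequence `k ↦ f (k - j)` for `f ∈ ℓ²(ℤ)`. -/
def translate (j : ℤ) (f : L2Z) : L2Z :=
  ⟨fun k => f (k - j), by
    have h : Summable fun k : ℤ => ‖f k‖ ^ (2 : ENNReal).toReal :=
      (memℓp_gen_iff (by norm_num)).1 (lp.memℓp f)
    exact memℓp_gen ((Equiv.subRight j).summable_iff.2 h)⟩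

@[simp] theorem translate_apply (j : ℤ) (f : L2Z) (k : ℤ) : translate j f k = f (k - j) := rfl

/-- The shift-invariant system `g_{m,n}(k) = g_m(k - n a)`, `m = 0, …, M - 1`, `n ∈ ℤ`. -/
def sis {M : ℕ} (a : ℕ) (g : Fin M → L2Z) : Fin M × ℤ → L2Z :=
  fun p => translate (p.2 * (a : ℤ)) (g p.1)

/-- The family `e` is a frame for the Hilbert space `E` with frame bounds `A, B`.  Mathlib's inner product is
linear in the second argument, so `⟪e i, f⟫_ℂ` is the usual coefficient `⟨f, e i⟩`. -/
structure IsFrame {E : Type*} [NormedAddCommGroup E] [InnerProductSpace ℂ E] {ι : Type*}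
    (e : ι → E) (A B : ℝ) : Prop where
  lower_pos : 0 < A
  upper_pos : 0 < B
  summable : ∀ f : E, Summable fun i => ‖⟪e i, f⟫_ℂ‖ ^ 2
  lower : ∀ f : E, A * ‖f‖ ^ 2 ≤ ∑' i, ‖⟪e i, f⟫_ℂ‖ ^ 2
  upper : ∀ f : E, ∑' i, ‖⟪e i, f⟫_ℂ‖ ^ 2 ≤ B * ‖f‖ ^ 2

section FrameOperator

variable {E : Type*} [NormedAddCommGroup E] [InnerProductSpace ℂ E]
  {ι : Type*} {e : ι → E} {A B : ℝ}

/-- The analysis operator `F f = (⟨f, e i⟩)_i` from `E` to `ℓ²(ι)`. -/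
def analysisOperator (h : IsFrame e A B) : E →L[ℂ] lp (fun _ : ι => ℂ) 2 :=
  LinearMap.mkContinuous
    { toFun := fun f => ⟨fun i => ⟪e i, f⟫_ℂ, memℓp_gen (by simpa using h.summable f)⟩
      map_add' := fun f f' => by ext i; exact inner_add_right _ _ _
      map_smul' := fun c f => by ext i; exact inner_smul_right _ _ _ }
    (Real.sqrt B) (fun f => by
      refine le_of_sq_le_sq ?_ (by positivity)
      rw [mul_pow, Real.sq_sqrt h.upper_pos.le]
      have h2 := lp.norm_rpow_eq_tsum (p := 2) (by norm_num)
        (⟨fun i => ⟪e i, f⟫_ℂ, memℓp_gen (by simpa using h.summable f)⟩ : lp (fun _ : ι => ℂ) 2)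
      simp only [ENNReal.toReal_ofNat, Real.rpow_ofNat] at h2
      exact h2.le.trans (h.upper f))

@[simp] theorem analysisOperator_apply (h : IsFrame e A B) (f : E) (i : ι) :
    analysisOperator h f i = ⟪e i, f⟫_ℂ := rfl

variable [CompleteSpace E]

/-- The frame operator `S = F* F`. -/
def frameOperator (h : IsFrame e A B) : E →L[ℂ] E :=
  (analysisOperator h).adjoint ∘L analysisOperator h

/-- `S f = ∑ i, ⟨f, e i⟩ e i`, with convergence in `E`. -/
theorem hasSum_frameOperator (h : IsFrame e A B) (f : E) :
    HasSum (fun i => ⟪e i, f⟫_ℂ • e i) (frameOperator h f) := by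
  classical
  have h1 := (lp.hasSum_single (p := 2) (by norm_num) (analysisOperator h f)).mapL
    (analysisOperator h).adjoint
  have h2 : ∀ i, (analysisOperator h).adjoint (lp.single 2 i (analysisOperator h f i)) =
      ⟪e i, f⟫_ℂ • e i := fun i => by
    refine ext_inner_left ℂ fun v => ?_
    rw [ContinuousLinearMap.adjoint_inner_right, lp.inner_single_right, inner_smul_right,
      analysisOperator_apply, analysisOperator_apply, RCLike.inner_apply, inner_conj_symm]
  simp only [h2] at h1
  exact h1

end FrameOperator

/-- The sequences in `ℓ²(ℤ)` supported in `[-N, N]`. -/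
def supportedIn (N : ℕ) : Submodule ℂ L2Z where
  carrier := {x | ∀ k : ℤ, (N : ℤ) < |k| → x k = 0}
  add_mem' := fun hx hy k hk => by simp [hx k hk, hy k hk]
  zero_mem' := fun k _ => by simp
  smul_mem' := fun c x hx k hk => by simp [hx k hk]

theorem mem_supportedIn {N : ℕ} {x : L2Z} :
    x ∈ supportedIn N ↔ ∀ k : ℤ, (N : ℤ) < |k| → x k = 0 := Iff.rfl

instance (N : ℕ) : CompleteSpace (supportedIn N) := by
  have h : IsClosed ((supportedIn N : Set L2Z)) := by
    have h1 : (supportedIn N : Set L2Z) =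
        ⋂ k : ℤ, ⋂ _ : (N : ℤ) < |k|, {x : L2Z | x k = 0} := by
      ext x
      simp [mem_supportedIn]
    rw [h1]
    refine isClosed_iInter fun k => isClosed_iInter fun _ => isClosed_eq ?_ continuous_const
    exact (lp.evalCLM ℂ (fun _ : ℤ => ℂ) 2 k).continuous
  exact h.completeSpace_coe

/-- The truncation `P_N x = (…, 0, x_{-N}, …, x_N, 0, …)`, viewed as a map onto its image. -/
def trunc (N : ℕ) : L2Z →L[ℂ] supportedIn N := (supportedIn N).orthogonalProjectionOnto

theorem trunc_apply (N : ℕ) (x : L2Z) (k : ℤ) :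
    (trunc N x : L2Z) k = if |k| ≤ (N : ℤ) then x k else 0 := by
  classical
  split_ifs with hk
  · have hmem : lp.single 2 k (1 : ℂ) ∈ supportedIn N := fun j hj =>
      lp.single_apply_ne 2 k _ (by rintro rfl; omega)
    have h := (supportedIn N).inner_orthogonalProjectionOnto_eq_of_mem_left ⟨_, hmem⟩ x
    rw [lp.inner_single_left] at h
    simp only [Submodule.coe_inner, lp.inner_single_left] at h
    simpa [trunc] using h
  · exact (trunc N x).2 k (by omega)

/-- The finite section `P_N T P_N`, as an operator on the finite-dimensional image of `P_N`. -/
def finiteSection (T : L2Z →L[ℂ] L2Z) (N : ℕ) : supportedIn N →L[ℂ] supportedIn N :=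
  trunc N ∘L T ∘L (supportedIn N).subtypeL

/-- The finite section method is applicable to `T`: from some `N₀` on, for every `y ∈ ℓ²(ℤ)` the
equation `P_N T P_N x = P_N y` has a unique solution `x = x^{(N)}` in the image of `P_N`, and the
`x^{(N)}` converge to the (unique) solution of `T x = y`. -/
def FiniteSectionApplicable (T : L2Z →L[ℂ] L2Z) : Prop :=
  ∃ N₀ : ℕ, ∀ y : L2Z, ∃ x : L2Z, (T x = y ∧ ∀ x', T x' = y → x' = x) ∧
    ∃ u : (N : ℕ) → supportedIn N,
      (∀ N, N₀ ≤ N → finiteSection T N (u N) = trunc N y ∧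
        ∀ v, finiteSection T N v = trunc N y → v = u N) ∧
      Filter.Tendsto (fun N => (u N : L2Z)) Filter.atTop (nhds x)

/-- The real power `T ^ r` of a positive operator `T` on a Hilbert space (for `r < 0`, of a positive
invertible operator), through the continuous functional calculus. -/
def opPow {E : Type*} [NormedAddCommGroup E] [InnerProductSpace ℂ E] [CompleteSpace E]
    (T : E →L[ℂ] E) (r : ℝ) : E →L[ℂ] E :=
  T ^ r

/-- The generators `φ_m = S^{-1/2} g_m` of the canonical tight frame. -/
def tightGen {M a : ℕ} {g : Fin M → L2Z} {A B : ℝ} (h : IsFrame (sis a g) A B) (m : Fin M) : L2Z :=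
  opPow (frameOperator h) (-(1 / 2)) (g m)

/-- The approximations `φ_m^{(N)} = (P_N S P_N)^{-1/2} P_N g_m`; the power is taken in the algebra
of operators on the image of `P_N`. -/
def tightGenApprox {M a : ℕ} {g : Fin M → L2Z} {A B : ℝ} (h : IsFrame (sis a g) A B)
    (N : ℕ) (m : Fin M) : L2Z :=
  (opPow (finiteSection (frameOperator h) N) (-(1 / 2)) (trunc N (g m)) : supportedIn N)

end ShiftInvariant

end

open ShiftInvariant

/-! The frame bounds say `A ≤ S ≤ B` in the Loewner order, and compression to `Im P_N` preserves
such inequalities.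

Hence `√A ≤ S^{1/2}` passes to all finite sections. They are uniformly invertible, and a Céa-type
estimate bounds the error of `x^{(N)}` by the truncation error of `x`
(`finiteSectionApplicable_of_algebraMap_le`).

For the rate, the binomial series gives polynomials close to `x^{-1/2}` on `[A, B]` with geometric
error. Both `S` and `P_N S P_N` have spectrum in `[A, B]`, so `p(S)` and `p(P_N S P_N)` approximate
both inverse square roots equally well. Since `S` widens supports by at most `2s`, the two
polynomials agree on `g_m` while the degree is of order `N / (2s)`. Only the approximation error is
left. -/

namespace ShiftInvariant

open Filter Topology

/-! ### Loewner bounds by scalars, coercivity and functional calculus -/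

section LoewnerOrder

variable {E : Type*} [NormedAddCommGroup E] [InnerProductSpace ℂ E]

theorem reApplyInnerSelf_mono {T T' : E →L[ℂ] E} (h : T ≤ T') (x : E) :
    T.reApplyInnerSelf x ≤ T'.reApplyInnerSelf x := by
  have := h.2 x
  simpa [ContinuousLinearMap.reApplyInnerSelf_apply, inner_sub_left] using this

theorem reApplyInnerSelf_algebraMap_real (c : ℝ) (x : E) :
    (algebraMap ℝ (E →L[ℂ] E) c).reApplyInnerSelf x = c * ‖x‖ ^ 2 := by
  rw [ContinuousLinearMap.reApplyInnerSelf_apply, Algebra.algebraMap_eq_smul_one]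
  simp only [smul_apply, one_apply_eq_self]
  rw [← Complex.coe_smul, inner_smul_left, Complex.conj_ofReal, RCLike.re_to_complex,
    Complex.re_ofReal_mul, ← RCLike.re_to_complex, inner_self_eq_norm_sq]

theorem mul_norm_sq_le_of_algebraMap_le {T : E →L[ℂ] E} {c : ℝ} (h : algebraMap ℝ _ c ≤ T)
    (x : E) : c * ‖x‖ ^ 2 ≤ ‖⟪T x, x⟫_ℂ‖ := by
  have h1 := reApplyInnerSelf_mono h x
  rw [reApplyInnerSelf_algebraMap_real] at h1
  exact h1.trans (RCLike.re_le_norm _)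

theorem mul_norm_le_of_algebraMap_le {T : E →L[ℂ] E} {c : ℝ} (h : algebraMap ℝ _ c ≤ T)
    (x : E) : c * ‖x‖ ≤ ‖T x‖ := by
  rcases (norm_nonneg x).eq_or_lt with hx | hx
  · simp [← hx]
  · refine le_of_mul_le_mul_right ?_ hx
    calc c * ‖x‖ * ‖x‖ = c * ‖x‖ ^ 2 := by ring
      _ ≤ ‖⟪T x, x⟫_ℂ‖ := mul_norm_sq_le_of_algebraMap_le h x
      _ ≤ ‖T x‖ * ‖x‖ := norm_inner_le_norm _ _

variable [CompleteSpace E]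

theorem isSelfAdjoint_algebraMap_real (c : ℝ) :
    IsSelfAdjoint (algebraMap ℝ (E →L[ℂ] E) c) :=
  (IsSelfAdjoint.all c).algebraMap _

theorem algebraMap_le_of_forall {T : E →L[ℂ] E} (hT : IsSelfAdjoint T) {c : ℝ}
    (h : ∀ x, c * ‖x‖ ^ 2 ≤ T.reApplyInnerSelf x) : algebraMap ℝ _ c ≤ T := by
  rw [ContinuousLinearMap.le_def, ContinuousLinearMap.isPositive_def']
  refine ⟨hT.sub (isSelfAdjoint_algebraMap_real c), fun x => ?_⟩
  have h1 := h x
  rw [← reApplyInnerSelf_algebraMap_real] at h1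
  simpa [ContinuousLinearMap.reApplyInnerSelf_apply, inner_sub_left] using h1

theorem le_algebraMap_of_forall {T : E →L[ℂ] E} (hT : IsSelfAdjoint T) {c : ℝ}
    (h : ∀ x, T.reApplyInnerSelf x ≤ c * ‖x‖ ^ 2) : T ≤ algebraMap ℝ _ c := by
  rw [ContinuousLinearMap.le_def, ContinuousLinearMap.isPositive_def']
  refine ⟨(isSelfAdjoint_algebraMap_real c).sub hT, fun x => ?_⟩
  have h1 := h x
  rw [← reApplyInnerSelf_algebraMap_real] at h1
  simpa [ContinuousLinearMap.reApplyInnerSelf_apply, inner_sub_left] using h1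

theorem algebraMap_real_nonneg {c : ℝ} (hc : 0 ≤ c) : 0 ≤ algebraMap ℝ (E →L[ℂ] E) c := by
  rw [ContinuousLinearMap.nonneg_iff_isPositive, ContinuousLinearMap.isPositive_def']
  refine ⟨isSelfAdjoint_algebraMap_real c, fun x => ?_⟩
  rw [reApplyInnerSelf_algebraMap_real]
  positivity

theorem bijective_of_algebraMap_le {T : E →L[ℂ] E} {c : ℝ} (hc : 0 < c)
    (h : algebraMap ℝ _ c ≤ T) : Function.Bijective T := by
  rw [← ContinuousLinearMap.isUnit_iff_bijective]
  refine ContinuousLinearMap.isUnit_of_forall_le_norm_inner_map T (c := ⟨c, hc.le⟩) hc fun x => ?_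
  rw [mul_comm]
  exact mul_norm_sq_le_of_algebraMap_le h x

theorem spectrum_subset_Icc {T : E →L[ℂ] E} {A B : ℝ} (hT : IsSelfAdjoint T)
    (hA : algebraMap ℝ _ A ≤ T) (hB : T ≤ algebraMap ℝ _ B) :
    spectrum ℝ T ⊆ Set.Icc A B := fun x hx =>
  ⟨(algebraMap_le_iff_le_spectrum hT).1 hA x hx, (le_algebraMap_iff_spectrum_le hT).1 hB x hx⟩

theorem algebraMap_sqrt_le_opPow_half {T : E →L[ℂ] E} {A : ℝ} (hA0 : 0 < A)
    (hA : algebraMap ℝ _ A ≤ T) : algebraMap ℝ _ (Real.sqrt A) ≤ opPow T (1 / 2) := by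
  have hT0 : 0 ≤ T := (algebraMap_real_nonneg hA0.le).trans hA
  have hT : IsSelfAdjoint T := IsSelfAdjoint.of_nonneg hT0
  rw [opPow, CFC.rpow_eq_cfc_real hT0]
  refine algebraMap_le_cfc _ _ T (fun x hx => ?_) ?_ hT
  · rw [← Real.sqrt_eq_rpow]
    exact Real.sqrt_le_sqrt ((algebraMap_le_iff_le_spectrum hT).1 hA x hx)
  · exact (Real.continuous_rpow_const (by norm_num)).continuousOn

/-- A uniform polynomial approximation of `x ^ r` on `[A, B]` is inherited by operators. -/
theorem norm_opPow_sub_aeval_le {T : E →L[ℂ] E} {A B : ℝ} (hA0 : 0 < A)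
    (hA : algebraMap ℝ _ A ≤ T) (hB : T ≤ algebraMap ℝ _ B) {r ε : ℝ} (hε : 0 ≤ ε)
    (p : Polynomial ℝ) (hp : ∀ x ∈ Set.Icc A B, |x ^ r - p.eval x| ≤ ε) :
    ‖opPow T r - Polynomial.aeval T p‖ ≤ ε := by
  have hT0 : 0 ≤ T := (algebraMap_real_nonneg hA0.le).trans hA
  have hT : IsSelfAdjoint T := IsSelfAdjoint.of_nonneg hT0
  have hsp := spectrum_subset_Icc hT hA hB
  have hcont : ContinuousOn (fun x : ℝ => x ^ r) (spectrum ℝ T) :=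
    continuousOn_id.rpow_const fun x hx => Or.inl (hA0.trans_le (hsp hx).1).ne'
  rw [opPow, CFC.rpow_eq_cfc_real hT0, ← cfc_polynomial p T hT,
    ← cfc_sub _ _ T hcont p.continuous.continuousOn]
  exact norm_cfc_le hε fun x hx => hp x (hsp hx)

end LoewnerOrder

/-! ### Frame bounds as operator inequalities -/

section FrameBounds

/-- Test the upper frame bound on `e i` itself and keep only the `i`-th term. -/
theorem norm_frame_le_sqrt {E : Type*} [NormedAddCommGroup E] [InnerProductSpace ℂ E]
    {ι : Type*} {e : ι → E} {A B : ℝ} (h : IsFrame e A B) (i : ι) : ‖e i‖ ≤ Real.sqrt B := by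
  rcases (norm_nonneg (e i)).eq_or_lt with hx | hx
  · rw [← hx]
    positivity
  · refine Real.le_sqrt_of_sq_le (le_of_mul_le_mul_right ?_ (pow_pos hx 2))
    calc ‖e i‖ ^ 2 * ‖e i‖ ^ 2 = ‖⟪e i, e i⟫_ℂ‖ ^ 2 := by
          rw [inner_self_eq_norm_sq_to_K]
          norm_num
          ring
      _ ≤ ∑' j, ‖⟪e j, e i⟫_ℂ‖ ^ 2 := (h.summable (e i)).le_tsum i fun _ _ => by positivity
      _ ≤ B * ‖e i‖ ^ 2 := h.upper _

variable {E : Type*} [NormedAddCommGroup E] [InnerProductSpace ℂ E] [CompleteSpace E]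
  {ι : Type*} {e : ι → E} {A B : ℝ}

theorem isSelfAdjoint_frameOperator (h : IsFrame e A B) : IsSelfAdjoint (frameOperator h) :=
  (ContinuousLinearMap.isPositive_adjoint_comp_self _).isSelfAdjoint

theorem reApplyInnerSelf_frameOperator (h : IsFrame e A B) (f : E) :
    (frameOperator h).reApplyInnerSelf f = ∑' i, ‖⟪e i, f⟫_ℂ‖ ^ 2 := by
  rw [ContinuousLinearMap.reApplyInnerSelf_apply, frameOperator,
    ContinuousLinearMap.comp_apply, ContinuousLinearMap.adjoint_inner_left, inner_self_eq_norm_sq]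
  have h2 := lp.norm_rpow_eq_tsum (p := 2) (by norm_num) (analysisOperator h f)
  simpa using h2

theorem algebraMap_le_frameOperator (h : IsFrame e A B) :
    algebraMap ℝ _ A ≤ frameOperator h :=
  algebraMap_le_of_forall (isSelfAdjoint_frameOperator h) fun f => by
    rw [reApplyInnerSelf_frameOperator]
    exact h.lower f

theorem frameOperator_le_algebraMap (h : IsFrame e A B) :
    frameOperator h ≤ algebraMap ℝ _ B :=
  le_algebraMap_of_forall (isSelfAdjoint_frameOperator h) fun f => by
    rw [reApplyInnerSelf_frameOperator]
    exact h.upper f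

end FrameBounds

/-! ### Compressions and convergence of the finite section method -/

section FiniteSection

theorem finiteSection_apply (T : L2Z →L[ℂ] L2Z) (N : ℕ) (v : supportedIn N) :
    finiteSection T N v = trunc N (T v) := rfl

theorem finiteSection_sub (T T' : L2Z →L[ℂ] L2Z) (N : ℕ) :
    finiteSection (T - T') N = finiteSection T N - finiteSection T' N := by
  ext1 v
  simp [finiteSection_apply]

theorem trunc_coe {N : ℕ} (v : supportedIn N) : trunc N v = v :=
  (supportedIn N).orthogonalProjectionOnto_mem_subspace_eq_self v

theorem trunc_of_mem {N : ℕ} {x : L2Z} (hx : x ∈ supportedIn N) : (trunc N x : L2Z) = x :=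
  congrArg Subtype.val (trunc_coe ⟨x, hx⟩)

theorem norm_trunc_le (N : ℕ) (x : L2Z) : ‖trunc N x‖ ≤ ‖x‖ :=
  (supportedIn N).norm_orthogonalProjectionOnto_apply_le x

theorem finiteSection_algebraMap (c : ℝ) (N : ℕ) :
    finiteSection (algebraMap ℝ _ c) N = algebraMap ℝ _ c := by
  ext1 v
  rw [finiteSection_apply, Algebra.algebraMap_eq_smul_one, Algebra.algebraMap_eq_smul_one]
  simp only [smul_apply, one_apply_eq_self]
  rw [(trunc N).map_smul_of_tower, trunc_coe]

theorem finiteSection_mono {T T' : L2Z →L[ℂ] L2Z} (h : T ≤ T') (N : ℕ) :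
    finiteSection T N ≤ finiteSection T' N := by
  rw [ContinuousLinearMap.le_def] at h ⊢
  rw [← finiteSection_sub]
  exact h.orthogonalProjectionOnto_comp _

theorem algebraMap_le_finiteSection {T : L2Z →L[ℂ] L2Z} {c : ℝ} (h : algebraMap ℝ _ c ≤ T)
    (N : ℕ) : algebraMap ℝ _ c ≤ finiteSection T N := by
  rw [← finiteSection_algebraMap]
  exact finiteSection_mono h N

theorem finiteSection_le_algebraMap {T : L2Z →L[ℂ] L2Z} {c : ℝ} (h : T ≤ algebraMap ℝ _ c)
    (N : ℕ) : finiteSection T N ≤ algebraMap ℝ _ c := by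
  rw [← finiteSection_algebraMap]
  exact finiteSection_mono h N

theorem supportedIn_mono : Monotone supportedIn := fun N N' h x hx k hk =>
  hx k (lt_of_le_of_lt (by exact_mod_cast h) hk)

theorem single_mem_supportedIn {N : ℕ} {k : ℤ} (hk : |k| ≤ (N : ℤ)) (c : ℂ) :
    lp.single 2 k c ∈ supportedIn N := fun j hj =>
  lp.single_apply_ne 2 k _ (by rintro rfl; omega)

/-- The union of the increasing subspaces is dense: a vector orthogonal to every coordinate vector
vanishes. -/
theorem tendsto_trunc (x : L2Z) :
    Tendsto (fun N => (trunc N x : L2Z)) atTop (𝓝 x) := by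
  refine Submodule.starProjection_tendsto_self supportedIn supportedIn_mono x (top_le_iff.2 ?_)
  rw [Submodule.topologicalClosure_eq_top_iff, Submodule.eq_bot_iff]
  intro y hy
  ext k
  have hmem : lp.single 2 k (1 : ℂ) ∈ ⨆ N, supportedIn N :=
    Submodule.mem_iSup_of_mem k.natAbs (single_mem_supportedIn k.abs_eq_natAbs.le 1)
  have := (Submodule.mem_orthogonal _ _).1 hy _ hmem
  rw [lp.inner_single_left] at this
  simpa using this

/-- The finite section method applies to every operator that is bounded below by a positive
constant in the Loewner order. -/
theorem finiteSectionApplicable_of_algebraMap_le {T : L2Z →L[ℂ] L2Z} {c : ℝ} (hc : 0 < c)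
    (h : algebraMap ℝ _ c ≤ T) : FiniteSectionApplicable T := by
  -- The lower bound `c` is inherited by every section, so no initial `N` has to be excluded.
  refine ⟨0, fun y => ?_⟩
  obtain ⟨hinj, hsurj⟩ := bijective_of_algebraMap_le hc h
  have hbij := fun N => bijective_of_algebraMap_le hc (algebraMap_le_finiteSection h N)
  obtain ⟨x, hx⟩ := hsurj y
  choose u hu using fun N => (hbij N).2 (trunc N y)
  refine ⟨x, ⟨hx, fun x' hx' => hinj (hx'.trans hx.symm)⟩, u,
    fun N _ => ⟨hu N, fun v hv => (hbij N).1 (hv.trans (hu N).symm)⟩, ?_⟩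
  -- Céa estimate: the section at `N` sends `u N - P_N x` to `P_N T (x - P_N x)`, and it is bounded
  -- below by `c` uniformly in `N`.
  have hbound : ∀ N, ‖(u N : L2Z) - trunc N x‖ ≤ c⁻¹ * (‖T‖ * ‖x - trunc N x‖) := fun N => by
    rw [inv_mul_eq_div, le_div_iff₀ hc, mul_comm]
    calc c * ‖(u N : L2Z) - trunc N x‖ = c * ‖u N - trunc N x‖ := rfl
      _ ≤ ‖finiteSection T N (u N - trunc N x)‖ :=
          mul_norm_le_of_algebraMap_le (algebraMap_le_finiteSection h N) _
      _ = ‖trunc N (T (x - trunc N x))‖ := by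
          rw [map_sub, hu, finiteSection_apply, map_sub T, map_sub, hx]
      _ ≤ ‖T (x - trunc N x)‖ := norm_trunc_le _ _
      _ ≤ ‖T‖ * ‖x - trunc N x‖ := T.le_opNorm _
  have h0 : Tendsto (fun N => x - (trunc N x : L2Z)) atTop (𝓝 0) := by
    simpa using (tendsto_const_nhds (x := x)).sub (tendsto_trunc x)
  have h1 : Tendsto (fun N => (u N : L2Z) - trunc N x) atTop (𝓝 0) :=
    squeeze_zero_norm hbound (by simpa using (h0.norm.const_mul ‖T‖).const_mul c⁻¹)
  simpa using h1.add (tendsto_trunc x)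

end FiniteSection

/-! ### Support growth, and exactness of truncation for low-degree polynomials -/

section Banded

/-- An operator that enlarges supports by at most `w` acts on sequences of small support in the
same way as its finite section. -/
theorem finiteSection_pow_trunc {T : L2Z →L[ℂ] L2Z} {w : ℕ}
    (hT : ∀ (n : ℕ) (x : L2Z), x ∈ supportedIn n → T x ∈ supportedIn (n + w))
    {s N k : ℕ} {x : L2Z} (hx : x ∈ supportedIn s) (hN : s + k * w ≤ N) :
    (T ^ k) x ∈ supportedIn (s + k * w) ∧
      ((finiteSection T N ^ k) (trunc N x) : L2Z) = (T ^ k) x := by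
  induction k with
  | zero =>
    simp only [zero_mul, add_zero, pow_zero, one_apply_eq_self] at hN ⊢
    exact ⟨hx, trunc_of_mem (supportedIn_mono hN hx)⟩
  | succ k ih =>
    have hs : s + (k + 1) * w = s + k * w + w := by ring
    obtain ⟨ih1, ih2⟩ := ih (by omega)
    have h1 : (T ^ (k + 1)) x ∈ supportedIn (s + (k + 1) * w) := by
      rw [pow_succ', hs]
      exact hT _ _ ih1
    refine ⟨h1, ?_⟩
    rw [pow_succ', mul_apply_eq_comp, finiteSection_apply, ih2]
    rw [pow_succ', mul_apply_eq_comp] at h1 ⊢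
    exact trunc_of_mem (supportedIn_mono hN h1)

theorem aeval_finiteSection_trunc {T : L2Z →L[ℂ] L2Z} {w : ℕ}
    (hT : ∀ (n : ℕ) (x : L2Z), x ∈ supportedIn n → T x ∈ supportedIn (n + w))
    {s N : ℕ} {x : L2Z} (hx : x ∈ supportedIn s) (p : Polynomial ℝ)
    (hN : s + p.natDegree * w ≤ N) :
    (Polynomial.aeval (finiteSection T N) p (trunc N x) : L2Z) = Polynomial.aeval T p x := by
  rw [Polynomial.aeval_eq_sum_range, Polynomial.aeval_eq_sum_range,
    sum_apply, sum_apply, Submodule.coe_sum]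
  refine Finset.sum_congr rfl fun k hk => ?_
  have hk' : k * w ≤ p.natDegree * w :=
    Nat.mul_le_mul_right _ (Nat.lt_succ_iff.1 (Finset.mem_range.1 hk))
  rw [smul_apply, smul_apply,
    ← (finiteSection_pow_trunc hT hx (show s + k * w ≤ N by omega)).2]
  rfl

/-- A translate that meets `[-n, n]` has its support within distance `2s` of that interval; all
other translates have zero coefficient. -/
theorem frameOperator_mem_supportedIn {M a : ℕ} {g : Fin M → L2Z} {A B : ℝ}
    (h : IsFrame (sis a g) A B) {s : ℕ} (hg : ∀ m, g m ∈ supportedIn s) (n : ℕ) (x : L2Z)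
    (hx : x ∈ supportedIn n) : frameOperator h x ∈ supportedIn (n + 2 * s) := by
  intro k hk
  have h1 := (hasSum_frameOperator h x).mapL (lp.evalCLM ℂ (fun _ : ℤ => ℂ) 2 k)
  refine h1.unique ?_
  have h0 : ∀ i, lp.evalCLM ℂ (fun _ : ℤ => ℂ) 2 k (⟪sis a g i, x⟫_ℂ • sis a g i) = 0 := by
    intro i
    change ⟪sis a g i, x⟫_ℂ * g i.1 (k - i.2 * (a : ℤ)) = 0
    by_cases hki : (s : ℤ) < |k - i.2 * (a : ℤ)|
    · rw [hg i.1 _ hki, mul_zero]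
    · have : ⟪sis a g i, x⟫_ℂ = 0 := by
        rw [lp.inner_eq_tsum]
        refine (tsum_congr fun j => ?_).trans tsum_zero
        by_cases hj : (n : ℤ) < |j|
        · rw [hx j hj, inner_zero_right]
        · have : sis a g i j = 0 := by
            change g i.1 (j - i.2 * (a : ℤ)) = 0
            refine hg i.1 _ ?_
            push_cast at hk
            generalize i.2 * (a : ℤ) = t at *
            -- Here `|k - j| > 2s` and `|k - t| ≤ s`, which forces `|j - t| > s`.
            rw [not_lt, abs_le] at *
            rw [lt_abs] at *
            omega
          rw [this, inner_zero_left]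
      rw [this, zero_mul]
  simp only [h0]
  exact hasSum_zero

end Banded

/-! ### Polynomial approximation of powers and the resulting error bound -/

section Approximation

/-- Polynomials of degree less than `n` approximate `x ^ r` on `[A, B]` with geometric error. -/
theorem exists_polynomial_geometric_approx_rpow (r : ℝ) {A B : ℝ} (hA : 0 < A) (hB : 0 < B) :
    ∃ q ∈ Set.Ioo (0 : ℝ) 1, ∃ C > 0, ∀ n : ℕ, ∃ p : Polynomial ℝ, p.natDegree ≤ n - 1 ∧
      (n = 0 → p = 0) ∧ ∀ x ∈ Set.Icc A B, |x ^ r - p.eval x| ≤ C * q ^ n := by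
  have hD : 0 < A + B := add_pos hA hB
  -- For `x` in `[A, B]`, `x / (A + B) - 1` lies in `[-B/(A+B), -A/(A+B)]`, hence in a ball of
  -- radius `ρ < 1` where the binomial series converges geometrically.
  obtain ⟨ρ, hρ1, hρ2⟩ := exists_between
    (max_lt ((div_lt_one hD).2 (by linarith) : A / (A + B) < 1)
      ((div_lt_one hD).2 (by linarith) : B / (A + B) < 1))
  obtain ⟨hρA, hρB⟩ := max_lt_iff.1 hρ1
  have hρ0 : 0 < ρ := (div_pos hA hD).trans hρA
  obtain ⟨q, hq, C, hC, happ⟩ :=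
    (Real.one_add_rpow_hasFPowerSeriesOnBall_zero (a := r)).uniform_geometric_approx
      (r' := ⟨ρ, hρ0.le⟩) (ENNReal.coe_lt_one_iff.2 hρ2)
  have hDr : 0 < (A + B) ^ r := Real.rpow_pos_of_pos hD r
  refine ⟨q, hq, (A + B) ^ r * C, mul_pos hDr hC, fun n => ?_⟩
  let L : Polynomial ℝ := Polynomial.C (A + B)⁻¹ * Polynomial.X - 1
  have hL : L.natDegree ≤ 1 :=
    (Polynomial.natDegree_sub_le _ _).trans
      (max_le ((Polynomial.natDegree_C_mul_le _ _).trans Polynomial.natDegree_X_le) (by simp))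
  refine ⟨Polynomial.C ((A + B) ^ r) *
    ∑ k ∈ Finset.range n, Polynomial.C (Ring.choose r k) * L ^ k, ?_, ?_, fun x hx => ?_⟩
  · refine (Polynomial.natDegree_C_mul_le _ _).trans
      (Polynomial.natDegree_sum_le_of_forall_le _ _ fun k hk => ?_)
    refine (Polynomial.natDegree_C_mul_le _ _).trans
      (Polynomial.natDegree_pow_le.trans ?_)
    have := Finset.mem_range.1 hk
    have := Nat.mul_le_mul_left k hL
    omega
  · rintro rfl
    simp
  · have hLx : L.eval x = x / (A + B) - 1 := by simp [L, div_eq_inv_mul]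
    have hy : x / (A + B) - 1 ∈ Metric.ball (0 : ℝ) ρ := by
      rw [mem_ball_zero_iff, Real.norm_eq_abs, abs_lt]
      have e1 : A / (A + B) + B / (A + B) = 1 := by rw [← add_div, div_self hD.ne']
      have e2 : A / (A + B) ≤ x / (A + B) := by gcongr; exact hx.1
      have e3 : x / (A + B) ≤ B / (A + B) := by gcongr; exact hx.2
      constructor <;> linarith
    have key := happ _ hy n
    have hx0 : 0 < x := hA.trans_le hx.1
    have e4 : x ^ r = (A + B) ^ r * (1 + (0 + (x / (A + B) - 1))) ^ r := by
      rw [← Real.mul_rpow hD.le (by have := div_pos hx0 hD; linarith)]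
      congr 1
      field_simp
      ring
    have e5 : (binomialSeries ℝ r).partialSum n (x / (A + B) - 1) =
        ∑ k ∈ Finset.range n, Ring.choose r k * (x / (A + B) - 1) ^ k := by
      refine Finset.sum_congr rfl fun k _ => ?_
      rw [binomialSeries_apply]
      simp
    rw [e5, Real.norm_eq_abs] at key
    rw [e4]
    simp only [Polynomial.eval_mul, Polynomial.eval_C, Polynomial.eval_finsetSum,
      Polynomial.eval_pow, hLx]
    rw [← mul_sub, abs_mul, abs_of_pos hDr, mul_assoc]
    exact mul_le_mul_of_nonneg_left key hDr.le

/-- The polynomial terms cancel, leaving one error `ε` for `S` and one for its section, each applied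
to a vector of norm at most `√B`. -/
theorem norm_tightGen_sub_tightGenApprox_le {M a : ℕ} {g : Fin M → L2Z} {A B : ℝ}
    (h : IsFrame (sis a g) A B) {s : ℕ} (hg : ∀ m, g m ∈ supportedIn s) {ε : ℝ} (hε : 0 ≤ ε)
    {N : ℕ} (p : Polynomial ℝ) (hdeg : p = 0 ∨ s + p.natDegree * (2 * s) ≤ N)
    (hp : ∀ x ∈ Set.Icc A B, |x ^ (-(1 / 2) : ℝ) - p.eval x| ≤ ε) (m : Fin M) :
    ‖tightGen h m - tightGenApprox h N m‖ ≤ 2 * ε * Real.sqrt B := by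
  have hgm : ‖g m‖ ≤ Real.sqrt B := by
    have h0 : sis a g (m, 0) = g m := by
      ext k
      simp [sis]
    exact h0 ▸ norm_frame_le_sqrt h (m, 0)
  have hS := norm_opPow_sub_aeval_le h.lower_pos (algebraMap_le_frameOperator h)
    (frameOperator_le_algebraMap h) hε p hp
  have hSN := norm_opPow_sub_aeval_le h.lower_pos
    (algebraMap_le_finiteSection (algebraMap_le_frameOperator h) N)
    (finiteSection_le_algebraMap (frameOperator_le_algebraMap h) N) hε p hp
  set S := frameOperator h
  have heq : (Polynomial.aeval (finiteSection S N) p (trunc N (g m)) : L2Z) =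
      Polynomial.aeval S p (g m) := by
    rcases hdeg with rfl | hdeg
    · simp
    · exact aeval_finiteSection_trunc (frameOperator_mem_supportedIn h hg) (hg m) p hdeg
  have hsplit : tightGen h m - tightGenApprox h N m =
      (opPow S (-(1 / 2)) - Polynomial.aeval S p) (g m) -
        ((opPow (finiteSection S N) (-(1 / 2)) - Polynomial.aeval (finiteSection S N) p)
          (trunc N (g m)) : supportedIn N) := by
    rw [sub_apply, sub_apply, Submodule.coe_sub, heq,
      sub_sub_sub_cancel_right]
    rfl
  rw [hsplit]
  calc _ ≤ ε * ‖g m‖ + ε * ‖trunc N (g m)‖ :=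
        (norm_sub_le _ _).trans (add_le_add (ContinuousLinearMap.le_of_opNorm_le _ hS _)
          (ContinuousLinearMap.le_of_opNorm_le _ hSN _))
    _ ≤ ε * Real.sqrt B + ε * Real.sqrt B := by
        have := norm_trunc_le N (g m)
        gcongr
        exact this.trans hgm
    _ = 2 * ε * Real.sqrt B := by ring

end Approximation

end ShiftInvariant

theorem theorem3 :
    (∀ (a M : ℕ) (g : Fin M → L2Z) (A B : ℝ), 0 < a →
      ∀ h : IsFrame (sis a g) A B,
        FiniteSectionApplicable (opPow (frameOperator h) (1 / 2))) ∧
    (∀ (A B : ℝ) (s : ℕ), 0 < A → 0 < B →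
      ∃ β K : ℝ, 0 < β ∧ β < 1 ∧ 0 < K ∧
        ∀ (a M : ℕ) (g : Fin M → L2Z), 0 < a →
          ∀ h : IsFrame (sis a g) A B,
            (∀ (m : Fin M) (k : ℤ), (s : ℤ) < |k| → g m k = 0) →
              ∀ (m : Fin M) (N : ℕ),
                ‖tightGen h m - tightGenApprox h N m‖ ≤ K * β ^ N) := by
  refine ⟨fun a M g A B _ h => finiteSectionApplicable_of_algebraMap_le
    (Real.sqrt_pos.2 h.lower_pos)
    (algebraMap_sqrt_le_opPow_half h.lower_pos (algebraMap_le_frameOperator h)),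
    fun A B s hA hB => ?_⟩
  obtain ⟨q, ⟨hq0, hq1⟩, C, hC, happ⟩ :=
    exists_polynomial_geometric_approx_rpow (-(1 / 2)) hA hB
  -- The step `2s + 1` rather than `2s` keeps the divisor positive when `s = 0`.
  have hw : 0 < 2 * s + 1 := by omega
  have hβ0 : 0 < q ^ (1 / ((2 * s + 1 : ℕ) : ℝ)) := Real.rpow_pos_of_pos hq0 _
  have hβ1 : q ^ (1 / ((2 * s + 1 : ℕ) : ℝ)) < 1 := Real.rpow_lt_one hq0.le hq1 (by positivity)
  have hβq : (q ^ (1 / ((2 * s + 1 : ℕ) : ℝ))) ^ (2 * s + 1) = q := by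
    rw [one_div, Real.rpow_inv_natCast_pow hq0.le hw.ne']
  have hsB : 0 < Real.sqrt B := Real.sqrt_pos.2 hB
  refine ⟨q ^ (1 / ((2 * s + 1 : ℕ) : ℝ)), 2 * C * Real.sqrt B / q, hβ0, hβ1, by positivity,
    fun a M g _ h hg m N => ?_⟩
  generalize q ^ (1 / ((2 * s + 1 : ℕ) : ℝ)) = β at *
  obtain ⟨p, hp1, hp0, hp⟩ := happ (N / (2 * s + 1))
  have hn := Nat.div_add_mod N (2 * s + 1)
  have hr := Nat.mod_lt N hw
  generalize N / (2 * s + 1) = n at *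
  -- For `N ≤ 2s` the support of `g_m` may already exceed `[-N, N]`; then `n = 0` and `p = 0`, so
  -- agreement is trivial.
  have hdeg : p = 0 ∨ s + p.natDegree * (2 * s) ≤ N := by
    rcases n with _ | n
    · exact Or.inl (hp0 rfl)
    · refine Or.inr ?_
      have h1 := Nat.mul_le_mul_right (2 * s) hp1
      simp only [Nat.add_sub_cancel] at h1
      have h2 : (2 * s + 1) * (n + 1) = n * (2 * s) + n + 2 * s + 1 := by ring
      omega
  refine (norm_tightGen_sub_tightGenApprox_le h hg (by positivity) p hdeg hp m).trans ?_
  -- Since `N < (2s + 1)(n + 1)`, one extra factor `q` makes up for the rounding in `n`; this is the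
  -- `1 / q` in the constant.
  have hpow : q ^ n * q ≤ β ^ N := by
    rw [← pow_succ, ← hβq, ← pow_mul]
    refine pow_le_pow_of_le_one hβ0.le hβ1.le ?_
    rw [mul_add]
    omega
  calc 2 * (C * q ^ n) * Real.sqrt B = 2 * C * Real.sqrt B / q * (q ^ n * q) := by
        field_simp
    _ ≤ 2 * C * Real.sqrt B / q * β ^ N := by gcongr
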